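/- Let $m,n\ge 0$ and $N\ge 1$ be integers, and let $a_i,b_i>0$ ($1\le i\le m$), $r_j>0$ ($1\le j\le n$), $\lambda>0$ and $\sigma_k>0$ ($1\le k\le N$) be real numbers; put $\sigma=\sigma_1\cdots\sigma_N$. Let $X_1,\dots,X_m,Y_1,\dots,Y_n,Z_1,\dots,Z_N$ be mutually independent real random variables, where $X_i\sim\mathrm{Beta}(a_i,b_i)$ has density $\frac{\Gamma(a_i+b_i)}{\Gamma(a_i)\Gamma(b_i)}x^{a_i-1}(1-x)^{b_i-1}$ on $(0,1)$, $Y_j\sim\Gamma(r_j,\lambda)$ has density $\frac{\lambda^{r_j}}{\Gamma(r_j)}x^{r_j-1}\mathrm e^{-\lambda x}$ on $(0,\infty)$, and $Z_k\sim N(0,\sigma_k^2)$. Let $X=\prod_{i=1}^m X_i$, $Y=\prod_{j=1}^nY_j$, $Z=\prod_{k=1}^NZ_k$ (empty products are $1$). Then $W=XYZ$ has a probability density function $p$ with respect to Lebesgue measure on $\mathbb R$, given for $x\in\mathbb R\setminus\{0\}$ by $$p(x)=K\,G^{2m+2n+N,\,0}_{2m,\,2m+2n+N}\left(\frac{\lambda^{2n}x^2}{2^{2n+N}\sigma^2}\;\middle|\;\begin{matrix}\frac{a_1+b_1}{2},\dots,\frac{a_m+b_m}{2},\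 \frac{a_1+b_1-1}{2},\dots,\frac{a_m+b_m-1}{2}\\[2pt] \frac{a_1}{2},\dots,\frac{a_m}{2},\ \frac{a_1-1}{2},\dots,\frac{a_m-1}{2},\ \frac{r_1}{2},\dots,\frac{r_n}{2},\ \frac{r_1-1}{2},\dots,\frac{r_n-1}{2},\ 0,\dots,0\end{matrix}\right)$$ with $N$ zeros at the end of the lower row, where $$K=\frac{\lambda^n}{2^{2n+N/2}\,\pi^{(n+N)/2}\,\sigma}\prod_{i=1}^m\frac{\Gamma(a_i+b_i)}{2^{b_i}\Gamma(a_i)}\prod_{j=1}^n\frac{2^{r_j}}{\Gamma(r_j)} .$$ Here the Meijer $G$-function is defined, for $z\ne0$, by $$G^{\mu,\nu}_{p,q}\left(z\;\middle|\;\begin{matrix}\alpha_1,\dots,\alpha_p\\ \beta_1,\dots,\beta_q\end{matrix}\right)=\frac1{2\pi \mathrm i}\int_{c-\mathrm i\infty}^{c+\mathrm i\infty}z^{-s}\,\frac{\prod_{j=1}^{\mu}\Gamma(s+\beta_j)\prod_{j=1}^{\nu}\Gamma(1-\alpha_j-s)}{\prod_{j=\nu+1}^{p}\Gamma(s+\alpha_j)\prod_{j=\mu+1}^{q}\Gamma(1-\beta_j-s)}\,\mathrm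 ds,$$ where $c$ is any real number such that the line $\operatorname{Re}s=c$ has the poles of the $\Gamma(s+\beta_j)$, $j\le\mu$, on its left and the poles of the $\Gamma(1-\alpha_j-s)$, $j\le\nu$, on its right. For the parameters and arguments above such $c$ exist, and for each of them the integral converges absolutely and has the same value. -/

import Mathlib

open MeasureTheory ProbabilityTheory

noncomputable section

/-- The integrand `z^{-s} ∏_{j ≤ m} Γ(s + b_j) ∏_{j ≤ n} Γ(1 - a_j - s) /
(∏_{j > n} Γ(s + a_j) ∏_{j > m} Γ(1 - b_j - s))` of the Meijer `G`-function `G^{m,n}_{p,q}`, where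
`p` and `q` are the lengths of the parameter lists `a` and `b`. (At a pole of a factor of the
denominator Mathlib's conventions give the quotient the value `0`, which is the value of the entire
function `1 / Γ` there.) -/
def meijerGIntegrand (m n : ℕ) (a b : List ℂ) (z s : ℂ) : ℂ :=
  z ^ (-s) *
    ((((b.take m).map fun β => Complex.Gamma (s + β)).prod *
        ((a.take n).map fun α => Complex.Gamma (1 - α - s)).prod) /
      (((a.drop n).map fun α => Complex.Gamma (s + α)).prod *
        ((b.drop m).map fun β => Complex.Gamma (1 - β - s)).prod))

/-- The vertical line `Re s = c` separates the poles `-β - k` of the `Γ(s + β)`, `β = b_1, …, b_m`,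
which lie to its left, from the poles `1 - α + k` of the `Γ(1 - α - s)`, `α = a_1, …, a_n`, which
lie to its right (`k = 0, 1, 2, …`). -/
def MeijerGSeparates (m n : ℕ) (a b : List ℂ) (c : ℝ) : Prop :=
  (∀ β ∈ b.take m, -β.re < c) ∧ (∀ α ∈ a.take n, c < 1 - α.re)

/-- The contour integral `(2πi)⁻¹ ∫_{c-i∞}^{c+i∞}` of the integrand, parametrized by
`s = c + it`, `ds = i dt`. -/
def meijerGLineIntegral (m n : ℕ) (a b : List ℂ) (c : ℝ) (z : ℂ) : ℂ :=
  1 / (2 * (Real.pi : ℂ) * Complex.I) *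
    ∫ t : ℝ, meijerGIntegrand m n a b z ((c : ℂ) + (t : ℂ) * Complex.I) * Complex.I

/-- `HasMeijerG m n a b z w`: the Meijer `G`-function with parameters `a` and `b` is defined at
`z ≠ 0` and has the value `w` there: there is a separating vertical line, and along each such line
the contour integral converges absolutely and has the value `w`. -/
structure HasMeijerG (m n : ℕ) (a b : List ℂ) (z w : ℂ) : Prop where
  ne_zero : z ≠ 0
  exists_separates : ∃ c : ℝ, MeijerGSeparates m n a b c
  integrable : ∀ c : ℝ, MeijerGSeparates m n a b c →
    Integrable (fun t : ℝ => meijerGIntegrand m n a b z ((c : ℂ) + (t : ℂ) * Complex.I)) volume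
  eq_value : ∀ c : ℝ, MeijerGSeparates m n a b c → meijerGLineIntegral m n a b c z = w

open scoped Classical in
/-- The Meijer `G`-function `G^{m,n}_{p,q}(z | a_1, …, a_p ; b_1, …, b_q)`, with `p = a.length`
and `q = b.length` (and the value `0` where it is not defined). -/
def meijerG (m n : ℕ) (a b : List ℂ) (z : ℂ) : ℂ :=
  if h : ∃ w, HasMeijerG m n a b z w then h.choose else 0

theorem HasMeijerG.meijerG_eq {m n : ℕ} {a b : List ℂ} {z w : ℂ} (h : HasMeijerG m n a b z w) :
    meijerG m n a b z = w := by
  have hex : ∃ w, HasMeijerG m n a b z w := ⟨w, h⟩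
  obtain ⟨c, hc⟩ := h.exists_separates
  rw [meijerG, dif_pos hex, ← hex.choose_spec.eq_value c hc, h.eq_value c hc]

/-- The upper parameters
`(a_1+b_1)/2, …, (a_m+b_m)/2, (a_1+b_1-1)/2, …, (a_m+b_m-1)/2`. -/
def bgnUpper {m : ℕ} (a b : Fin m → ℝ) : List ℂ :=
  List.ofFn (fun i => (((a i + b i) / 2 : ℝ) : ℂ)) ++
    List.ofFn (fun i => (((a i + b i - 1) / 2 : ℝ) : ℂ))

/-- The lower parameters
`a_1/2, …, a_m/2, (a_1-1)/2, …, (a_m-1)/2, r_1/2, …, r_n/2, (r_1-1)/2, …, (r_n-1)/2, 0, …, 0`,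
with `N` zeros at the end. -/
def bgnLower {m n : ℕ} (a : Fin m → ℝ) (r : Fin n → ℝ) (N : ℕ) : List ℂ :=
  List.ofFn (fun i => ((a i / 2 : ℝ) : ℂ)) ++
    List.ofFn (fun i => (((a i - 1) / 2 : ℝ) : ℂ)) ++
    List.ofFn (fun j => ((r j / 2 : ℝ) : ℂ)) ++
    List.ofFn (fun j => (((r j - 1) / 2 : ℝ) : ℂ)) ++
    List.replicate N 0

theorem length_bgnUpper {m : ℕ} (a b : Fin m → ℝ) : (bgnUpper a b).length = 2 * m := by
  simp [bgnUpper]; ring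

theorem length_bgnLower {m n : ℕ} (a : Fin m → ℝ) (r : Fin n → ℝ) (N : ℕ) :
    (bgnLower a r N).length = 2 * m + 2 * n + N := by
  simp [bgnLower]; ring

/-- The constant `K = λ^n / (2^{2n+N/2} π^{(n+N)/2} σ) ∏ Γ(a_i+b_i) / (2^{b_i} Γ(a_i))
∏ 2^{r_j} / Γ(r_j)`, with `l` for `λ` and `s` for `σ`. -/
def bgnConst {m n : ℕ} (a b : Fin m → ℝ) (r : Fin n → ℝ) (l : ℝ) (N : ℕ) (s : ℝ) : ℝ :=
  l ^ n / ((2 : ℝ) ^ (2 * (n : ℝ) + (N : ℝ) / 2) * Real.pi ^ (((n : ℝ) + (N : ℝ)) / 2) * s) *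
    (∏ i, Real.Gamma (a i + b i) / ((2 : ℝ) ^ (b i) * Real.Gamma (a i))) *
    ∏ j, (2 : ℝ) ^ (r j) / Real.Gamma (r j)

end

noncomputable section

/-! Single out one normal factor `Z_k`, with standard deviation `σ_k`, and let `V` be the product of
all the others, which is almost surely nonzero. Conditionally on `V = v`, the product `W = V Z_k` is
centred normal with standard deviation `|v| σ_k`, so `W` has density `p(x) = E[φ(x)]` with `φ` the
density of `N(0, (V σ_k)²)`.

Mellin inversion is needed only for `exp (-y)`: it writes that normal density as a contour integral
over `Re s = c` of `|v|^(2s-1) |x|^(-2s)` times the moment of `|Z_k|` of order `2s-1`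
(`gaussianPDFReal_eq_vertical_integral`). Fubini moves the expectation inside and turns `|V|^(2s-1)`
into a product of known moments (`gaussian_mixture_vertical_integral`, `hasAbsMoment_finset_prod`).
Absolute convergence comes from the factor `Γ(s)` of `Z_k` alone, since `|E |V|^(2s-1)|` is bounded
on the line by `E |V|^(2c-1)`.

Legendre's duplication formula then splits each beta and gamma moment into the paired parameters of
the `G`-function, up to the constant `K` (`prod_bgnMoment_eq_meijerGIntegrand`). As `p` is defined
without reference to `c`, all admissible lines give the same value, with no contour shift. -/

/-! ### The Gamma function on vertical lines and Mellin inversion of the exponential -/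

open Set in
theorem norm_Gamma_le_Gamma_re {s : ℂ} (hs : 0 < s.re) : ‖Complex.Gamma s‖ ≤ Real.Gamma s.re := by
  rw [Complex.Gamma_eq_integral hs, Real.Gamma_eq_integral hs, Complex.GammaIntegral]
  refine (norm_integral_le_integral_norm _).trans_eq ?_
  refine setIntegral_congr_fun measurableSet_Ioi fun x hx => ?_
  have hx : 0 < x := hx
  simp only [norm_mul, Complex.norm_real, Real.norm_eq_abs, abs_of_pos (Real.exp_pos _)]
  rw [Complex.norm_cpow_eq_rpow_re_of_pos hx]
  simp

theorem continuous_Gamma_vertical {c : ℝ} (hc : 0 < c) :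
    Continuous fun y : ℝ => Complex.Gamma (c + y * Complex.I) := by
  refine continuous_iff_continuousAt.2 fun y => ?_
  have : ContinuousAt Complex.Gamma (c + y * Complex.I) := by
    refine (Complex.differentiableAt_Gamma _ fun m h => ?_).continuousAt
    have := congrArg Complex.re h
    simp at this
    have : (0 : ℝ) ≤ m := m.cast_nonneg
    linarith
  exact this.comp (f := fun y : ℝ => (c : ℂ) + y * Complex.I) (by fun_prop)

/-- Two uses of the functional equation give `|Γ(s)| ≤ Γ(c+2) / (|s| |s+1|)`, and `|s+1| ≥ |s|`
bounds this by `Γ(c+2) / (c² + y²)`. Quadratic decay suffices, so Stirling's formula is not needed.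
-/
theorem integrable_Gamma_vertical {c : ℝ} (hc : 0 < c) :
    Integrable fun y : ℝ => Complex.Gamma (c + y * Complex.I) := by
  have hint : Integrable fun y : ℝ => Real.Gamma (c + 2) * (c ^ 2)⁻¹ * (1 + (c⁻¹ * y) ^ 2)⁻¹ :=
    (integrable_inv_one_add_sq.comp_mul_left' (inv_ne_zero hc.ne')).const_mul _
  refine hint.mono' (continuous_Gamma_vertical hc).aestronglyMeasurable (.of_forall fun y => ?_)
  set s : ℂ := c + y * Complex.I with hs
  have hre : s.re = c := by simp [hs]
  have him : s.im = y := by simp [hs]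
  have hs0 : s ≠ 0 := fun h => hc.ne' (by rw [← hre, h, Complex.zero_re])
  have hs1 : s + 1 ≠ 0 := fun h => by
    have := congrArg Complex.re h
    simp [hre] at this
    linarith
  have h2 : Complex.Gamma (s + 2) = (s + 1) * (s * Complex.Gamma s) := by
    rw [← Complex.Gamma_add_one s hs0, ← Complex.Gamma_add_one _ hs1]
    ring_nf
  have h3 : ‖Complex.Gamma (s + 2)‖ ≤ Real.Gamma (c + 2) := by
    have := norm_Gamma_le_Gamma_re (s := s + 2) (by simp [hre]; linarith)
    simpa [hre] using this
  have h4 : c ^ 2 + y ^ 2 ≤ ‖s + 1‖ * ‖s‖ := by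
    have e : c ^ 2 + y ^ 2 = ‖s‖ * ‖s‖ := by
      rw [← sq, ← Complex.normSq_eq_norm_sq, Complex.normSq_apply, hre, him]; ring
    rw [e]
    gcongr
    rw [← sq_le_sq₀ (norm_nonneg _) (norm_nonneg _), ← Complex.normSq_eq_norm_sq,
      ← Complex.normSq_eq_norm_sq, Complex.normSq_apply, Complex.normSq_apply]
    simp [hre, him]
    nlinarith
  have h5 : Real.Gamma (c + 2) * (c ^ 2)⁻¹ * (1 + (c⁻¹ * y) ^ 2)⁻¹
      = Real.Gamma (c + 2) / (c ^ 2 + y ^ 2) := by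
    field_simp
  rw [h5, le_div_iff₀ (by positivity)]
  refine le_trans ?_ h3
  rw [h2, norm_mul, norm_mul]
  nlinarith [norm_nonneg (Complex.Gamma s)]

theorem hasMellin_exp_neg {s : ℂ} (hs : 0 < s.re) :
    HasMellin (fun x : ℝ => ((Real.exp (-x) : ℝ) : ℂ)) s (Complex.Gamma s) := by
  constructor
  · have := Complex.GammaIntegral_convergent hs
    simpa only [MellinConvergent, smul_eq_mul, mul_comm] using this
  · rw [← Complex.GammaIntegral_eq_mellin, Complex.Gamma_eq_integral hs]

theorem exp_neg_eq_integral_Gamma {c y : ℝ} (hc : 0 < c) (hy : 0 < y) :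
    ((Real.exp (-y) : ℝ) : ℂ) = 1 / (2 * Real.pi) *
      ∫ t : ℝ, (y : ℂ) ^ (-((c : ℂ) + t * Complex.I)) * Complex.Gamma (c + t * Complex.I) := by
  have hm : ∀ t : ℝ, mellin (fun x : ℝ => ((Real.exp (-x) : ℝ) : ℂ)) (c + t * Complex.I)
      = Complex.Gamma (c + t * Complex.I) := fun t => (hasMellin_exp_neg (by simpa)).2
  have key := mellinInv_mellin_eq c (fun x : ℝ => ((Real.exp (-x) : ℝ) : ℂ)) hy
    (hasMellin_exp_neg (by simpa)).1
    (by
      rw [Complex.VerticalIntegrable]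
      simp_rw [hm]
      exact integrable_Gamma_vertical hc)
    (by fun_prop)
  rw [← key, mellinInv]
  simp_rw [hm, smul_eq_mul]
  rw [Complex.real_smul]
  push_cast
  rfl

/-! ### Complex absolute moments of the beta, gamma and normal laws -/

/-- The complex absolute moment of order `s` of `μ` converges absolutely and has the value `M`. -/
structure HasAbsMoment (μ : Measure ℝ) (s M : ℂ) : Prop where
  integrable : Integrable (fun x : ℝ => ((|x| : ℝ) : ℂ) ^ s) μ
  integral_eq : ∫ x : ℝ, ((|x| : ℝ) : ℂ) ^ s ∂μ = M

theorem measurable_abs_cpow (s : ℂ) : Measurable fun x : ℝ => ((|x| : ℝ) : ℂ) ^ s := by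
  fun_prop

/-- Split the line at `0`: each half contributes a Mellin transform, at `s + 1` because the Mellin
kernel is `x^(s-1)`. -/
theorem hasAbsMoment_withDensity_of_mellin {f : ℝ → ℝ} (hf : Measurable f) (hf0 : ∀ x, 0 ≤ f x)
    {s M M' : ℂ} (h : HasMellin (fun x => (f x : ℂ)) (s + 1) M)
    (h' : HasMellin (fun x => (f (-x) : ℂ)) (s + 1) M') :
    HasAbsMoment (volume.withDensity fun x => ENNReal.ofReal (f x)) s (M + M') := by
  have hfm : Measurable fun x => ENNReal.ofReal (f x) := hf.ennreal_ofReal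
  have e : ∀ x, (ENNReal.ofReal (f x)).toReal • ((|x| : ℝ) : ℂ) ^ s
      = ((|x| : ℝ) : ℂ) ^ s * f x := fun x => by
    rw [ENNReal.toReal_ofReal (hf0 x), Complex.real_smul, mul_comm]
  have aux : ∀ {g : ℝ → ℝ} {A : ℂ}, HasMellin (fun x => (g x : ℂ)) (s + 1) A →
      IntegrableOn (fun x : ℝ => ((|x| : ℝ) : ℂ) ^ s * g x) (Set.Ioi 0) ∧
        ∫ x in Set.Ioi (0 : ℝ), ((|x| : ℝ) : ℂ) ^ s * g x = A := by
    intro g A hg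
    have hc : Set.EqOn (fun x : ℝ => (x : ℂ) ^ (s + 1 - 1) • (g x : ℂ))
        (fun x : ℝ => ((|x| : ℝ) : ℂ) ^ s * g x) (Set.Ioi 0) := fun x hx => by
      simp only [add_sub_cancel_right, smul_eq_mul, abs_of_pos (show 0 < x from hx)]
    exact ⟨IntegrableOn.congr_fun hg.1 hc measurableSet_Ioi,
      by rw [← setIntegral_congr_fun measurableSet_Ioi hc]; exact hg.2⟩
  obtain ⟨i1, v1⟩ := aux h
  obtain ⟨i2, v2⟩ := aux h'
  have i3 : IntegrableOn (fun x : ℝ => ((|x| : ℝ) : ℂ) ^ s * f x) (Set.Iio 0) := by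
    have := (Measure.measurePreserving_neg (volume : Measure ℝ)).integrableOn_comp_preimage
      (MeasurableEquiv.neg ℝ).measurableEmbedding
      (f := fun x : ℝ => ((|x| : ℝ) : ℂ) ^ s * f x) (s := Set.Iio 0)
    rw [← this]
    simpa [Function.comp_def] using i2
  have i3' : IntegrableOn (fun x : ℝ => ((|x| : ℝ) : ℂ) ^ s * f x) (Set.Iic 0) :=
    (integrableOn_Iic_iff_integrableOn_Iio).2 i3
  have v3 : ∫ x in Set.Iic (0 : ℝ), ((|x| : ℝ) : ℂ) ^ s * f x = M' := by
    rw [← v2, ← neg_zero, ← integral_comp_neg_Ioi]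
    simp
  constructor
  · rw [integrable_withDensity_iff_integrable_smul' hfm (by simp)]
    simp_rw [e]
    rw [← integrableOn_univ, ← Set.Iic_union_Ioi (a := (0 : ℝ))]
    exact i3'.union i1
  · rw [integral_withDensity_eq_integral_toReal_smul hfm (by simp)]
    simp_rw [e]
    rw [← intervalIntegral.integral_Iic_add_Ioi i3' i1, v1, v3, add_comm]

theorem hasMellin_zero_on_pos {f : ℝ → ℂ} (hf : ∀ x, 0 < x → f x = 0) (s : ℂ) :
    HasMellin f s 0 := by
  have hc : Set.EqOn (fun x : ℝ => (x : ℂ) ^ (s - 1) • f x) 0 (Set.Ioi 0) := fun x hx => by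
    simp [hf x hx]
  constructor
  · exact IntegrableOn.congr_fun (integrable_zero _ _ _).integrableOn hc.symm measurableSet_Ioi
  · rw [mellin, setIntegral_congr_fun measurableSet_Ioi hc]; simp

theorem HasMellin.congr {f g : ℝ → ℂ} {s A : ℂ} (h : HasMellin f s A)
    (hfg : Set.EqOn f g (Set.Ioi 0)) : HasMellin g s A := by
  have hc : Set.EqOn (fun x : ℝ => (x : ℂ) ^ (s - 1) • f x) (fun x : ℝ => (x : ℂ) ^ (s - 1) • g x)
    (Set.Ioi 0) := fun x hx => by simp only [hfg hx]
  exact ⟨IntegrableOn.congr_fun h.1 hc measurableSet_Ioi,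
    by rw [mellin, ← setIntegral_congr_fun measurableSet_Ioi hc]; exact h.2⟩

theorem hasMellin_exp_neg_mul {s : ℂ} (hs : 0 < s.re) {l : ℝ} (hl : 0 < l) :
    HasMellin (fun x : ℝ => ((Real.exp (-(l * x)) : ℝ) : ℂ)) s
      ((l : ℂ) ^ (-s) * Complex.Gamma s) := by
  have h := hasMellin_exp_neg hs
  refine ⟨(MellinConvergent.comp_mul_left hl).2 h.1, ?_⟩
  have := mellin_comp_mul_left (fun x : ℝ => ((Real.exp (-x) : ℝ) : ℂ)) s hl
  rw [h.2] at this
  exact this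

theorem hasAbsMoment_gamma {r l : ℝ} (hr : 0 < r) (hl : 0 < l) {s : ℂ} (hs : -r < s.re) :
    HasAbsMoment (gammaMeasure r l) s
      (Complex.Gamma (r + s) / (Complex.Gamma r * (l : ℂ) ^ s)) := by
  have h1 := hasMellin_exp_neg_mul (s := r + s) (by simp; linarith) hl
  have h2 : HasMellin (fun x : ℝ => (x : ℂ) ^ ((r : ℂ) - 1) • ((Real.exp (-(l * x)) : ℝ) : ℂ))
      (s + 1) ((l : ℂ) ^ (-((r : ℂ) + s)) * Complex.Gamma (r + s)) := by
    have e : s + 1 + ((r : ℂ) - 1) = r + s := by ring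
    refine ⟨?_, ?_⟩
    · rw [MellinConvergent.cpow_smul, e]
      exact h1.1
    · rw [mellin_cpow_smul, e]
      exact h1.2
  have h3 := hasMellin_const_smul h2.1 ((l : ℂ) ^ (r : ℂ) / Complex.Gamma r)
  rw [h2.2] at h3
  have h4 : HasMellin (fun x => (gammaPDFReal r l x : ℂ)) (s + 1)
      (Complex.Gamma (r + s) / (Complex.Gamma r * (l : ℂ) ^ s)) := by
    have hl' : (l : ℂ) ≠ 0 := by exact_mod_cast hl.ne'
    have e : ((l : ℂ) ^ (r : ℂ) / Complex.Gamma r) •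
        ((l : ℂ) ^ (-((r : ℂ) + s)) * Complex.Gamma (r + s)) =
        Complex.Gamma (r + s) / (Complex.Gamma r * (l : ℂ) ^ s) := by
      have h0 : (l : ℂ) ^ (r : ℂ) ≠ 0 := by simp [Complex.cpow_eq_zero_iff, hl']
      rw [smul_eq_mul, neg_add, Complex.cpow_add _ _ hl', Complex.cpow_neg, Complex.cpow_neg]
      field_simp
    rw [← e]
    refine h3.congr fun x hx => ?_
    have hx : 0 < x := hx
    simp only [gammaPDFReal, if_pos hx.le, smul_eq_mul]
    push_cast
    rw [Complex.Gamma_ofReal, Complex.ofReal_cpow hl.le, Complex.ofReal_cpow hx.le]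
    push_cast
    ring
  have h5 : HasMellin (fun x => (gammaPDFReal r l (-x) : ℂ)) (s + 1) 0 :=
    hasMellin_zero_on_pos (fun x hx => by simp [gammaPDFReal, hx]) _
  have := hasAbsMoment_withDensity_of_mellin (measurable_gammaPDFReal r l)
    (gammaPDFReal_nonneg hr hl) h4 h5
  rwa [add_zero] at this

/-- Weighting the density by `x^s` replaces `a` by `a + s` in the beta integral. -/
theorem hasAbsMoment_beta {a b : ℝ} (ha : 0 < a) (hb : 0 < b) {s : ℂ} (hs : -a < s.re) :
    HasAbsMoment (betaMeasure a b) s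
      (Complex.Gamma (a + b) / Complex.Gamma a *
        (Complex.Gamma (a + s) / Complex.Gamma (a + b + s))) := by
  have hs' : 0 < ((a : ℂ) + s).re := by simp; linarith
  have hb' : 0 < (b : ℂ).re := by simpa
  have h1 := Complex.betaIntegral_convergent hs' hb'
  rw [intervalIntegrable_iff_integrableOn_Ioo_of_le zero_le_one] at h1
  have h2 := Complex.Gamma_mul_Gamma_eq_betaIntegral hs' hb'
  have hsub : Set.Ioo (0 : ℝ) 1 ⊆ Set.Ioi 0 := fun x hx => hx.1
  have hE : ∀ x : ℝ, 0 < x → (x : ℂ) ^ (s + 1 - 1) • (betaPDFReal a b x : ℂ) =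
      (Set.Ioo (0 : ℝ) 1).indicator (fun x : ℝ => ((1 / beta a b : ℝ) : ℂ) *
        ((x : ℂ) ^ ((a : ℂ) + s - 1) * (1 - (x : ℂ)) ^ ((b : ℂ) - 1))) x := by
    intro x hx
    by_cases h : x < 1
    · rw [Set.indicator_of_mem (show x ∈ Set.Ioo (0 : ℝ) 1 from ⟨hx, h⟩), betaPDFReal,
        if_pos ⟨hx, h⟩]
      have hx' : (x : ℂ) ≠ 0 := by exact_mod_cast hx.ne'
      have e : (a : ℂ) + s - 1 = s + (a - 1) := by ring
      rw [e, Complex.cpow_add _ _ hx', add_sub_cancel_right, Complex.ofReal_mul,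
        Complex.ofReal_mul, Complex.ofReal_cpow hx.le, Complex.ofReal_cpow (by linarith),
        smul_eq_mul]
      push_cast
      ring
    · rw [Set.indicator_of_notMem (fun h' => h h'.2), betaPDFReal, if_neg (fun h' => h h'.2)]
      simp
  have h3 : HasMellin (fun x => (betaPDFReal a b x : ℂ)) (s + 1)
      (Complex.Gamma (a + b) / Complex.Gamma a *
        (Complex.Gamma (a + s) / Complex.Gamma (a + b + s))) := by
    constructor
    · refine IntegrableOn.congr_fun ?_ (fun x hx => (hE x hx).symm) measurableSet_Ioi
      rw [integrableOn_indicator_iff measurableSet_Ioo]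
      exact IntegrableOn.mono_set (Integrable.const_mul h1 _) Set.inter_subset_left
    · rw [mellin, setIntegral_congr_fun measurableSet_Ioi (fun x hx => hE x hx),
        setIntegral_indicator measurableSet_Ioo, Set.inter_eq_self_of_subset_right hsub,
        integral_const_mul, ← integral_Ioc_eq_integral_Ioo,
        ← intervalIntegral.integral_of_le zero_le_one]
      change _ * Complex.betaIntegral _ _ = _
      have g1 := Complex.Gamma_ne_zero_of_re_pos (s := (a : ℂ)) (by simpa)
      have g2 := Complex.Gamma_ne_zero_of_re_pos hb'
      have g3 := Complex.Gamma_ne_zero_of_re_pos (s := (a : ℂ) + b + s) (by simp; linarith)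
      have e : (a : ℂ) + s + b = a + b + s := by ring
      rw [e] at h2
      rw [beta]
      push_cast [← Complex.Gamma_ofReal]
      rw [eq_comm, mul_comm, ← div_eq_iff_mul_eq g3] at h2
      rw [← h2]
      field_simp
  have h5 : HasMellin (fun x => (betaPDFReal a b (-x) : ℂ)) (s + 1) 0 :=
    hasMellin_zero_on_pos (fun x hx => by
      rw [betaPDFReal, if_neg (fun h => by linarith [h.1])]; simp) _
  have := hasAbsMoment_withDensity_of_mellin (measurable_betaPDFReal a b) (fun x => by
    by_cases h : 0 < x ∧ x < 1
    · exact (betaPDFReal_pos h.1 h.2 ha hb).le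
    · rw [betaPDFReal, if_neg h]) h3 h5
  rwa [add_zero] at this

/-- The substitution `x ↦ x²` reduces each half-line to a Gamma integral at `(s+1)/2`; by symmetry
the two halves contribute equally. -/
theorem hasAbsMoment_gaussian {σ : ℝ} (hσ : 0 < σ) {s : ℂ} (hs : -1 < s.re) :
    HasAbsMoment (gaussianReal 0 (Real.toNNReal (σ ^ 2))) s
      (((2 * σ ^ 2 : ℝ) : ℂ) ^ (s / 2) * Complex.Gamma ((s + 1) / 2) /
        ((Real.sqrt Real.pi : ℝ) : ℂ)) := by
  have hv : Real.toNNReal (σ ^ 2) ≠ 0 := by simp; positivity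
  set d : ℝ := 2 * σ ^ 2 with hd
  have hd0 : 0 < d := by positivity
  have hre : 0 < ((s + 1) / ((2 : ℝ) : ℂ)).re := by
    rw [Complex.div_ofReal_re]; simp; linarith
  have h1 := hasMellin_exp_neg_mul hre (l := d⁻¹) (by positivity)
  have h2 : HasMellin (fun x : ℝ => ((Real.exp (-(d⁻¹ * x ^ (2 : ℝ))) : ℝ) : ℂ)) (s + 1)
      (|(2 : ℝ)|⁻¹ • (((d⁻¹ : ℝ) : ℂ) ^ (-((s + 1) / ((2 : ℝ) : ℂ))) *
        Complex.Gamma ((s + 1) / ((2 : ℝ) : ℂ)))) := by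
    constructor
    · exact (MellinConvergent.comp_rpow (f := fun x : ℝ => ((Real.exp (-(d⁻¹ * x)) : ℝ) : ℂ))
        (two_ne_zero)).2 h1.1
    · have := mellin_comp_rpow (fun x : ℝ => ((Real.exp (-(d⁻¹ * x)) : ℝ) : ℂ)) (s + 1) 2
      rw [h1.2] at this
      exact this
  have h3 := hasMellin_const_smul h2.1 (((Real.sqrt (d * Real.pi))⁻¹ : ℝ) : ℂ)
  rw [h2.2] at h3
  have heq : ∀ x : ℝ, gaussianPDFReal 0 (Real.toNNReal (σ ^ 2)) x =
      (Real.sqrt (d * Real.pi))⁻¹ * Real.exp (-(d⁻¹ * x ^ 2)) := fun x => by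
    rw [gaussianPDFReal, Real.coe_toNNReal _ (by positivity), hd]
    congr 2
    · congr 1; ring_nf
    · rw [sub_zero]; field_simp
  have h4 : HasMellin (fun x => (gaussianPDFReal 0 (Real.toNNReal (σ ^ 2)) x : ℂ)) (s + 1)
      ((d : ℂ) ^ (s / 2) * Complex.Gamma ((s + 1) / 2) / ((Real.sqrt Real.pi : ℝ) : ℂ) / 2) := by
    have hd' : (d : ℂ) ≠ 0 := by exact_mod_cast hd0.ne'
    have hds : (d : ℂ) ^ ((s + 1) / 2) = (d : ℂ) ^ (s / 2) * ((Real.sqrt d : ℝ) : ℂ) := by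
      rw [add_div, Complex.cpow_add _ _ hd', Real.sqrt_eq_rpow, Complex.ofReal_cpow hd0.le]
      norm_num
    have e : (((Real.sqrt (d * Real.pi))⁻¹ : ℝ) : ℂ) •
        (|(2 : ℝ)|⁻¹ • (((d⁻¹ : ℝ) : ℂ) ^ (-((s + 1) / ((2 : ℝ) : ℂ))) *
          Complex.Gamma ((s + 1) / ((2 : ℝ) : ℂ)))) =
        (d : ℂ) ^ (s / 2) * Complex.Gamma ((s + 1) / 2) / ((Real.sqrt Real.pi : ℝ) : ℂ) / 2 := by
      have harg : (d : ℂ).arg ≠ Real.pi := by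
        rw [Complex.arg_ofReal_of_nonneg hd0.le]; exact Real.pi_ne_zero.symm
      have hq : ((Real.sqrt d : ℝ) : ℂ) ≠ 0 := by
        exact_mod_cast (Real.sqrt_pos.2 hd0).ne'
      have hq' : ((Real.sqrt Real.pi : ℝ) : ℂ) ≠ 0 := by
        exact_mod_cast (Real.sqrt_pos.2 Real.pi_pos).ne'
      rw [Complex.ofReal_inv, Complex.ofReal_inv, Complex.inv_cpow _ _ harg, Complex.cpow_neg,
        inv_inv, Complex.real_smul, smul_eq_mul, Complex.ofReal_ofNat, hds,
        Real.sqrt_mul hd0.le]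
      push_cast
      rw [abs_of_pos (two_pos)]
      push_cast
      field_simp
    rw [← e]
    refine h3.congr fun x _ => ?_
    simp only [heq x, smul_eq_mul]
    push_cast
    simp
  have h5 : HasMellin (fun x => (gaussianPDFReal 0 (Real.toNNReal (σ ^ 2)) (-x) : ℂ)) (s + 1)
      ((d : ℂ) ^ (s / 2) * Complex.Gamma ((s + 1) / 2) / ((Real.sqrt Real.pi : ℝ) : ℂ) / 2) := by
    have : ∀ x, gaussianPDFReal 0 (Real.toNNReal (σ ^ 2)) (-x) =
      gaussianPDFReal 0 (Real.toNNReal (σ ^ 2)) x := fun x => by simp [heq]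
    simp_rw [this]
    exact h4
  have := hasAbsMoment_withDensity_of_mellin (measurable_gaussianPDFReal 0 _)
    (gaussianPDFReal_nonneg 0 _) h4 h5
  rw [add_halves] at this
  rwa [gaussianReal_of_var_ne_zero _ hv]

/-! ### Normal densities and their scale mixtures as contour integrals -/

/-- The absolute moment of order `s` of the centred normal law with standard deviation `σ`. -/
def gaussianAbsMoment (σ : ℝ) (s : ℂ) : ℂ :=
  ((2 * σ ^ 2 : ℝ) : ℂ) ^ (s / 2) * Complex.Gamma ((s + 1) / 2) / ((Real.sqrt Real.pi : ℝ) : ℂ)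

theorem ofReal_cpow_eq_exp {u : ℝ} (hu : 0 < u) (s : ℂ) :
    (u : ℂ) ^ s = Complex.exp ((Real.log u : ℝ) * s) := by
  rw [Complex.cpow_def_of_ne_zero (by exact_mod_cast hu.ne'), Complex.ofReal_log hu.le]

/-- This is the inversion formula for `exp (-y)` at `y = x² / (2σ²v²)`. The order `2s - 1` is the
one for which the Gamma factor of the normal moment is exactly `Γ(s)`. -/
theorem gaussianPDFReal_eq_vertical_integral {σ v x c : ℝ} (hσ : 0 < σ) (hv : v ≠ 0) (hx : x ≠ 0)
    (hc : 0 < c) :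
    (gaussianPDFReal 0 (Real.toNNReal ((v * σ) ^ 2)) x : ℂ) = 1 / (2 * Real.pi) *
      ∫ t : ℝ, ((|v| : ℝ) : ℂ) ^ (2 * ((c : ℂ) + t * Complex.I) - 1) *
        (((|x| : ℝ) : ℂ) ^ (-2 * ((c : ℂ) + t * Complex.I)) *
          gaussianAbsMoment σ (2 * ((c : ℂ) + t * Complex.I) - 1)) := by
  set d : ℝ := 2 * σ ^ 2 with hd
  have hd0 : 0 < d := by positivity
  have hv' : 0 < |v| := abs_pos.2 hv
  have hx' : 0 < |x| := abs_pos.2 hx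
  have hy : 0 < |x| ^ 2 / (d * |v| ^ 2) := by positivity
  have hpdf : gaussianPDFReal 0 (Real.toNNReal ((v * σ) ^ 2)) x =
      (|v| * Real.sqrt d * Real.sqrt Real.pi)⁻¹ * Real.exp (-(|x| ^ 2 / (d * |v| ^ 2))) := by
    rw [gaussianPDFReal, Real.coe_toNNReal _ (by positivity)]
    congr 2
    · rw [show 2 * Real.pi * (v * σ) ^ 2 = |v| ^ 2 * d * Real.pi by rw [sq_abs, hd]; ring,
        Real.sqrt_mul (by positivity), Real.sqrt_mul (by positivity), Real.sqrt_sq (abs_nonneg v)]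
    · rw [sq_abs, sq_abs, sub_zero, hd]; field_simp
  have hlog : Real.log (|x| ^ 2 / (d * |v| ^ 2)) =
      2 * Real.log |x| - Real.log d - 2 * Real.log |v| := by
    rw [Real.log_div (by positivity) (by positivity), Real.log_mul hd0.ne' (by positivity),
      Real.log_pow, Real.log_pow]
    push_cast; ring
  have hk : (((|v| * Real.sqrt d)⁻¹ : ℝ) : ℂ) =
      Complex.exp (-(Real.log |v| : ℝ) - (Real.log d : ℝ) / 2) := by
    rw [← Real.exp_log (show 0 < (|v| * Real.sqrt d)⁻¹ by positivity), Real.log_inv,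
      Real.log_mul hv'.ne' (by positivity), Real.log_sqrt hd0.le]
    push_cast; ring_nf
  rw [hpdf, Complex.ofReal_mul, exp_neg_eq_integral_Gamma hc hy, mul_left_comm,
    ← integral_const_mul]
  congr 2
  funext t
  set s : ℂ := (c : ℂ) + t * Complex.I
  -- All powers have positive real bases, so writing them as exponentials of real logarithms reduces
  -- the identity to one between exponents.
  rw [gaussianAbsMoment, mul_inv, Complex.ofReal_mul, hk, ← hd, ofReal_cpow_eq_exp hy,
    ofReal_cpow_eq_exp hv', ofReal_cpow_eq_exp hx', ofReal_cpow_eq_exp hd0, hlog,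
    show (2 * s - 1 + 1) / 2 = s by ring]
  have : Complex.exp (-(Real.log |v| : ℝ) - (Real.log d : ℝ) / 2) *
      Complex.exp (((2 * Real.log |x| - Real.log d - 2 * Real.log |v| : ℝ) : ℂ) * -s) =
      Complex.exp ((Real.log |v| : ℝ) * (2 * s - 1)) * (Complex.exp ((Real.log |x| : ℝ) * (-2 * s)) *
        Complex.exp ((Real.log d : ℝ) * ((2 * s - 1) / 2))) := by
    rw [← Complex.exp_add, ← Complex.exp_add, ← Complex.exp_add]
    congr 1
    push_cast; ring
  rw [Complex.ofReal_inv]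
  linear_combination (Complex.Gamma s * ((Real.sqrt Real.pi : ℝ) : ℂ)⁻¹) * this

theorem integrable_gaussianAbsMoment_vertical {σ c x : ℝ} (hσ : 0 < σ) (hc : 0 < c) (hx : x ≠ 0) :
    Integrable fun t : ℝ => ((|x| : ℝ) : ℂ) ^ (-2 * ((c : ℂ) + t * Complex.I)) *
      gaussianAbsMoment σ (2 * ((c : ℂ) + t * Complex.I) - 1) := by
  have hx' : 0 < |x| := abs_pos.2 hx
  have hd0 : 0 < 2 * σ ^ 2 := by positivity
  have e : ∀ t : ℝ, ((|x| : ℝ) : ℂ) ^ (-2 * ((c : ℂ) + t * Complex.I)) *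
      gaussianAbsMoment σ (2 * ((c : ℂ) + t * Complex.I) - 1) =
      (((|x| : ℝ) : ℂ) ^ (-2 * ((c : ℂ) + t * Complex.I)) *
        ((2 * σ ^ 2 : ℝ) : ℂ) ^ ((2 * ((c : ℂ) + t * Complex.I) - 1) / 2) *
          ((Real.sqrt Real.pi : ℝ) : ℂ)⁻¹) * Complex.Gamma (c + t * Complex.I) := fun t => by
    rw [gaussianAbsMoment, show (2 * ((c : ℂ) + t * Complex.I) - 1 + 1) / 2 = c + t * Complex.I
      by ring]
    ring
  simp_rw [e]
  refine (integrable_Gamma_vertical hc).bdd_mul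
    (c := |x| ^ (-2 * c) * (2 * σ ^ 2) ^ ((2 * c - 1) / 2) * (Real.sqrt Real.pi)⁻¹) ?_ ?_
  · exact Measurable.aestronglyMeasurable (by fun_prop)
  · refine .of_forall fun t => le_of_eq ?_
    rw [norm_mul, norm_mul, Complex.norm_cpow_eq_rpow_re_of_pos hx',
      Complex.norm_cpow_eq_rpow_re_of_pos hd0, norm_inv, Complex.norm_real,
      Real.norm_of_nonneg (Real.sqrt_nonneg _)]
    congr 3
    · simp
    · rw [← Complex.ofReal_ofNat 2, Complex.div_ofReal_re]; simp

/-- Fubini applies because the modulus of `|v|^(2s-1)` is constant along the line: the integrand is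
dominated by a product of a function of `v` and a function of `t`. -/
theorem gaussian_mixture_vertical_integral {μ : Measure ℝ} [SFinite μ] (hμ : ∀ᵐ v ∂μ, v ≠ 0)
    {σ c x : ℝ} (hσ : 0 < σ) (hc : 0 < c) (hx : x ≠ 0) {M : ℂ → ℂ}
    (hM : ∀ t : ℝ, HasAbsMoment μ (2 * ((c : ℂ) + t * Complex.I) - 1)
      (M (2 * ((c : ℂ) + t * Complex.I) - 1))) :
    Integrable (fun v => gaussianPDFReal 0 (Real.toNNReal ((v * σ) ^ 2)) x) μ ∧
    Integrable (fun t : ℝ => M (2 * ((c : ℂ) + t * Complex.I) - 1) *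
      (((|x| : ℝ) : ℂ) ^ (-2 * ((c : ℂ) + t * Complex.I)) *
        gaussianAbsMoment σ (2 * ((c : ℂ) + t * Complex.I) - 1))) ∧
    ((∫ v, gaussianPDFReal 0 (Real.toNNReal ((v * σ) ^ 2)) x ∂μ : ℝ) : ℂ) =
      1 / (2 * Real.pi) * ∫ t : ℝ, M (2 * ((c : ℂ) + t * Complex.I) - 1) *
      (((|x| : ℝ) : ℂ) ^ (-2 * ((c : ℂ) + t * Complex.I)) *
        gaussianAbsMoment σ (2 * ((c : ℂ) + t * Complex.I) - 1)) := by
  set g : ℝ → ℂ := fun t => ((|x| : ℝ) : ℂ) ^ (-2 * ((c : ℂ) + t * Complex.I)) *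
        gaussianAbsMoment σ (2 * ((c : ℂ) + t * Complex.I) - 1) with hg
  have hgi : Integrable g := integrable_gaussianAbsMoment_vertical hσ hc hx
  set F : ℝ × ℝ → ℂ := fun p =>
    ((|p.1| : ℝ) : ℂ) ^ (2 * ((c : ℂ) + p.2 * Complex.I) - 1) * g p.2 with hF
  have hFi : Integrable F (μ.prod volume) := by
    -- At `t = 0` the moment hypothesis says that `|v|^(2c-1)` is integrable.
    have h0 := ((hM 0).integrable.norm).mul_prod hgi.norm
    refine h0.mono ?_ ?_
    · refine AEStronglyMeasurable.mul ?_ hgi.aestronglyMeasurable.comp_snd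
      exact Measurable.aestronglyMeasurable (by fun_prop)
    · have : ∀ᵐ p ∂(μ.prod (volume : Measure ℝ)), p.1 ≠ 0 :=
        Measure.quasiMeasurePreserving_fst.ae hμ
      filter_upwards [this] with p hp
      have hp' : 0 < |p.1| := abs_pos.2 hp
      rw [hF, norm_mul, Real.norm_of_nonneg (by positivity),
        Complex.norm_cpow_eq_rpow_re_of_pos hp', Complex.norm_cpow_eq_rpow_re_of_pos hp']
      simp
  have hpdf : (fun v => (gaussianPDFReal 0 (Real.toNNReal ((v * σ) ^ 2)) x : ℂ)) =ᵐ[μ]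
      fun v => 1 / (2 * Real.pi) * ∫ t : ℝ, F (v, t) := by
    filter_upwards [hμ] with v hv
    exact gaussianPDFReal_eq_vertical_integral hσ hv hx hc
  have hinner : ∀ t : ℝ, ∫ v, F (v, t) ∂μ = M (2 * ((c : ℂ) + t * Complex.I) - 1) * g t :=
    fun t => by
      rw [hF]
      simp only
      rw [integral_mul_const, (hM t).integral_eq]
  refine ⟨?_, ?_, ?_⟩
  · have h1 : Integrable (fun v => (gaussianPDFReal 0 (Real.toNNReal ((v * σ) ^ 2)) x : ℂ)) μ :=
      (hFi.integral_prod_left.const_mul _).congr hpdf.symm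
    simpa using h1.re
  · have := hFi.integral_prod_right
    simpa only [hinner] using this
  · rw [← integral_complex_ofReal]
    refine (integral_congr_ae hpdf).trans ?_
    rw [integral_const_mul, integral_integral_swap hFi]
    simp_rw [hinner]
    rfl

/-! ### The law of a product with an independent normal factor -/

theorem gaussianReal_map_const_mul_eq_withDensity {σ v : ℝ} (hσ : 0 < σ) (hv : v ≠ 0) :
    (gaussianReal 0 (Real.toNNReal (σ ^ 2))).map (v * ·) =
      volume.withDensity (gaussianPDF 0 (Real.toNNReal ((v * σ) ^ 2))) := by
  have e : (.mk (v ^ 2) (sq_nonneg _) * Real.toNNReal (σ ^ 2) : NNReal)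
      = Real.toNNReal ((v * σ) ^ 2) := by
    apply NNReal.eq
    rw [NNReal.coe_mul, Real.coe_toNNReal _ (by positivity), Real.coe_toNNReal _ (by positivity),
      mul_pow]
    rfl
  rw [gaussianReal_map_const_mul, mul_zero, e, gaussianReal_of_var_ne_zero]
  exact (Real.toNNReal_pos.2 (by positivity)).ne'

theorem measurable_gaussianPDFReal_scale (σ : ℝ) :
    Measurable fun p : ℝ × ℝ => gaussianPDFReal 0 (Real.toNNReal ((p.1 * σ) ^ 2)) p.2 :=
  measurable_uncurry_gaussianPDFReal.comp
    (f := fun p : ℝ × ℝ => ((0 : ℝ), Real.toNNReal ((p.1 * σ) ^ 2), p.2)) (by fun_prop)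

theorem map_mul_gaussian {Ω : Type*} [MeasurableSpace Ω] {P : Measure Ω} [IsProbabilityMeasure P]
    {V Z : Ω → ℝ} (hV : AEMeasurable V P) {σ : ℝ} (hσ : 0 < σ)
    (hZ : HasLaw Z (gaussianReal 0 (Real.toNNReal (σ ^ 2))) P) (hVZ : IndepFun V Z P)
    (hV0 : ∀ᵐ v ∂(P.map V), v ≠ 0) :
    P.map (fun ω => V ω * Z ω) = volume.withDensity fun x =>
      ∫⁻ v, ENNReal.ofReal (gaussianPDFReal 0 (Real.toNNReal ((v * σ) ^ 2)) x) ∂(P.map V) := by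
  have hprob : IsProbabilityMeasure (P.map V) := Measure.isProbabilityMeasure_map hV
  have hmeas := (measurable_gaussianPDFReal_scale σ).ennreal_ofReal
  have h1 : P.map (fun ω => V ω * Z ω) =
      ((P.map V).prod (gaussianReal 0 (Real.toNNReal (σ ^ 2)))).map (fun p => p.1 * p.2) := by
    rw [← hZ.map_eq, ← (indepFun_iff_map_prod_eq_prod_map_map hV hZ.aemeasurable).1 hVZ,
      AEMeasurable.map_map_of_aemeasurable (by fun_prop) (hV.prodMk hZ.aemeasurable)]
    rfl
  ext S hS
  rw [h1, Measure.map_apply (by fun_prop) hS,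
    Measure.prod_apply ((show Measurable fun p : ℝ × ℝ => p.1 * p.2 by fun_prop) hS),
    withDensity_apply _ hS, lintegral_lintegral_swap]
  · refine lintegral_congr_ae ?_
    filter_upwards [hV0] with v hv
    have := gaussianReal_map_const_mul_eq_withDensity hσ hv
    have h2 := congrArg (fun m => m S) this
    rw [Measure.map_apply (by fun_prop) hS, withDensity_apply _ hS] at h2
    exact h2
  · exact (hmeas.comp measurable_swap).aemeasurable

theorem ofReal_prod_cpow {ι : Type*} (S : Finset ι) {u : ι → ℝ} (hu : ∀ i, 0 ≤ u i) (s : ℂ) :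
    ((∏ i ∈ S, u i : ℝ) : ℂ) ^ s = ∏ i ∈ S, (u i : ℂ) ^ s := by
  classical
  induction S using Finset.induction_on with
  | empty => simp
  | insert a S ha ih =>
    rw [Finset.prod_insert ha, Finset.prod_insert ha, Complex.ofReal_mul,
      Complex.mul_cpow_ofReal_nonneg (hu a) (Finset.prod_nonneg fun i _ => hu i), ih]

theorem hasAbsMoment_finset_prod {Ω ι : Type*} [MeasurableSpace Ω] {P : Measure Ω}
    [IsProbabilityMeasure P] {U : ι → Ω → ℝ} (hU : ∀ i, AEMeasurable (U i) P)
    (hind : iIndepFun U P) (S : Finset ι) {s : ℂ} {M : ι → ℂ}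
    (hM : ∀ i, HasAbsMoment (P.map (U i)) s (M i)) :
    HasAbsMoment (P.map (∏ i ∈ S, U i)) s (∏ i ∈ S, M i) := by
  have hprob : ∀ i, IsProbabilityMeasure (P.map (U i)) := fun i =>
    Measure.isProbabilityMeasure_map (hU i)
  have hS : iIndepFun (fun i : S => U i) P := hind.precomp Subtype.val_injective
  have hUS : ∀ i : S, AEMeasurable (U i) P := fun i => hU i
  have hpi := (iIndepFun_iff_map_fun_eq_pi_map hUS).1 hS
  have hmap : P.map (∏ i ∈ S, U i) =
      (Measure.pi fun i : S => P.map (U i)).map (fun x => ∏ i, x i) := by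
    rw [← hpi, AEMeasurable.map_map_of_aemeasurable (by fun_prop) (by fun_prop)]
    congr 1
    funext ω
    simp only [Finset.prod_apply, Function.comp]
    exact (Finset.prod_coe_sort S fun i => U i ω).symm
  have hpow : ∀ x : S → ℝ, ((|∏ i, x i| : ℝ) : ℂ) ^ s = ∏ i, ((|x i| : ℝ) : ℂ) ^ s := fun x => by
    rw [Finset.abs_prod]
    exact ofReal_prod_cpow _ (fun i => abs_nonneg (x i)) s
  have hpm : Measurable fun x : S → ℝ => ∏ i, x i := by fun_prop
  constructor
  · rw [hmap, integrable_map_measure (measurable_abs_cpow s).aestronglyMeasurable hpm.aemeasurable]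
    simp only [Function.comp_def, hpow]
    exact Integrable.fintype_prod (f := fun (_ : S) (x : ℝ) => ((|x| : ℝ) : ℂ) ^ s)
      fun i => (hM i).integrable
  · rw [hmap, integral_map hpm.aemeasurable (measurable_abs_cpow s).aestronglyMeasurable]
    simp only [hpow]
    rw [integral_fintype_prod_eq_prod fun (_ : S) (x : ℝ) => ((|x| : ℝ) : ℂ) ^ s]
    simp only [(hM _).integral_eq]
    exact Finset.prod_coe_sort S M

/-- The density is the normal mixture over the law of the remaining product. It is fixed before any
abscissa is chosen, so one `p` serves every `c ∈ C`. -/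
theorem exists_density_prod_of_gaussian_factor {Ω ι : Type*} [Fintype ι] [DecidableEq ι]
    [MeasurableSpace Ω] {P : Measure Ω} [IsProbabilityMeasure P] {U : ι → Ω → ℝ}
    (hU : ∀ i, AEMeasurable (U i) P) (hind : iIndepFun U P)
    (hac : ∀ i, P.map (U i) ≪ volume) (k : ι) {σ : ℝ} (hσ : 0 < σ)
    (hk : HasLaw (U k) (gaussianReal 0 (Real.toNNReal (σ ^ 2))) P)
    {C : Set ℝ} (hC : C.Nonempty) (hC0 : ∀ c ∈ C, 0 < c) {M : ι → ℂ → ℂ}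
    (hM : ∀ c ∈ C, ∀ t : ℝ, ∀ i, HasAbsMoment (P.map (U i)) (2 * ((c : ℂ) + t * Complex.I) - 1)
      (M i (2 * ((c : ℂ) + t * Complex.I) - 1)))
    (hMk : M k = gaussianAbsMoment σ) :
    ∃ p : ℝ → ℝ, Measurable p ∧ (∀ x, 0 ≤ p x) ∧
      HasLaw (fun ω => ∏ i, U i ω) (volume.withDensity fun x => ENNReal.ofReal (p x)) P ∧
      ∀ c ∈ C, ∀ x : ℝ, x ≠ 0 →
        Integrable (fun t : ℝ => ((|x| : ℝ) : ℂ) ^ (-2 * ((c : ℂ) + t * Complex.I)) *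
          ∏ i, M i (2 * ((c : ℂ) + t * Complex.I) - 1)) ∧
        (p x : ℂ) = 1 / (2 * Real.pi) *
          ∫ t : ℝ, ((|x| : ℝ) : ℂ) ^ (-2 * ((c : ℂ) + t * Complex.I)) *
            ∏ i, M i (2 * ((c : ℂ) + t * Complex.I) - 1) := by
  set V : Ω → ℝ := ∏ i ∈ Finset.univ.erase k, U i with hVdef
  have hV : AEMeasurable V P := Finset.aemeasurable_prod _ fun i _ => hU i
  have hVZ : IndepFun V (U k) P :=
    hind.indepFun_finsetProd_of_notMem₀ hU (Finset.notMem_erase k _)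
  have hprob : IsProbabilityMeasure (P.map V) := Measure.isProbabilityMeasure_map hV
  have hae : ∀ᵐ x : ℝ, x ≠ 0 := by simp [ae_iff]
  have hV0 : ∀ᵐ v ∂(P.map V), v ≠ 0 := by
    refine (ae_map_iff hV (measurableSet_singleton (0 : ℝ)).compl).2 ?_
    have : ∀ᵐ ω ∂P, ∀ i, U i ω ≠ 0 := ae_all_iff.2 fun i =>
      ae_of_ae_map (hU i) ((hac i).ae_le hae)
    filter_upwards [this] with ω hω
    rw [hVdef, Finset.prod_apply]
    exact Finset.prod_ne_zero_iff.2 fun i _ => hω i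
  have key := fun (c : ℝ) (hc : c ∈ C) (x : ℝ) (hx : x ≠ 0) =>
    gaussian_mixture_vertical_integral hV0 hσ (hC0 c hc) hx
      (M := fun s => ∏ i ∈ Finset.univ.erase k, M i s)
      (fun t => hasAbsMoment_finset_prod hU hind _ (hM c hc t))
  refine ⟨fun x => ∫ v, gaussianPDFReal 0 (Real.toNNReal ((v * σ) ^ 2)) x ∂(P.map V), ?_, ?_, ?_, ?_⟩
  · exact (measurable_gaussianPDFReal_scale σ).stronglyMeasurable.integral_prod_left.measurable
  · exact fun x => integral_nonneg fun v => gaussianPDFReal_nonneg _ _ _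
  · have hprod : (fun ω => ∏ i, U i ω) = fun ω => V ω * U k ω := by
      funext ω
      rw [hVdef, Finset.prod_apply, Finset.prod_erase_mul _ _ (Finset.mem_univ k)]
    rw [hprod]
    refine ⟨hV.mul (hU k), ?_⟩
    rw [map_mul_gaussian hV hσ hk hVZ hV0]
    refine withDensity_congr_ae ?_
    -- A single abscissa yields integrability of the mixture at each `x ≠ 0`, which equates its
    -- Lebesgue and Bochner integrals.
    obtain ⟨c, hc⟩ := hC
    filter_upwards [hae] with x hx
    exact (ofReal_integral_eq_lintegral_ofReal (key c hc x hx).1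
      (.of_forall fun v => gaussianPDFReal_nonneg _ _ _)).symm
  · intro c hc x hx
    have e : ∀ t : ℝ, ((|x| : ℝ) : ℂ) ^ (-2 * ((c : ℂ) + t * Complex.I)) *
        ∏ i, M i (2 * ((c : ℂ) + t * Complex.I) - 1) =
        (∏ i ∈ Finset.univ.erase k, M i (2 * ((c : ℂ) + t * Complex.I) - 1)) *
        (((|x| : ℝ) : ℂ) ^ (-2 * ((c : ℂ) + t * Complex.I)) *
          gaussianAbsMoment σ (2 * ((c : ℂ) + t * Complex.I) - 1)) := fun t => by
      rw [← Finset.prod_erase_mul _ _ (Finset.mem_univ k), hMk]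
      ring
    simp_rw [e]
    exact (key c hc x hx).2

/-! ### From moments to the integrand of the `G`-function -/

/-- Legendre duplication at `s + (u-1)/2`; this is the source of the parameter pairs `u/2`,
`(u-1)/2`. -/
theorem Gamma_two_mul_sub_one_add (s : ℂ) (u : ℝ) :
    Complex.Gamma (u + (2 * s - 1)) = (2 : ℂ) ^ (2 * s + u - 2) / ((Real.sqrt Real.pi : ℝ) : ℂ) *
      (Complex.Gamma (s + ((u / 2 : ℝ) : ℂ)) * Complex.Gamma (s + (((u - 1) / 2 : ℝ) : ℂ))) := by
  have h := Complex.Gamma_mul_Gamma_add_half (s + (((u - 1) / 2 : ℝ) : ℂ))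
  have e1 : s + (((u - 1) / 2 : ℝ) : ℂ) + 1 / 2 = s + ((u / 2 : ℝ) : ℂ) := by push_cast; ring
  have e2 : 2 * (s + (((u - 1) / 2 : ℝ) : ℂ)) = u + (2 * s - 1) := by push_cast; ring
  have e3 : 1 - (u + (2 * s - 1)) = -(2 * s + u - 2) := by ring
  rw [e1, e2, e3, Complex.cpow_neg] at h
  have hpi : ((Real.sqrt Real.pi : ℝ) : ℂ) ≠ 0 := by
    exact_mod_cast (Real.sqrt_pos.2 Real.pi_pos).ne'
  have h2 : (2 : ℂ) ^ (2 * s + u - 2) ≠ 0 := by simp [Complex.cpow_eq_zero_iff]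
  rw [mul_comm (Complex.Gamma (s + ((u / 2 : ℝ) : ℂ))), h]
  field_simp

/-- The duplication factors of numerator and denominator cancel up to `2^(-b)`, so beta factors do
not affect the argument of the `G`-function. -/
theorem beta_moment_eq {a b : ℝ} (s : ℂ) :
    Complex.Gamma (a + b) / Complex.Gamma a *
        (Complex.Gamma (a + (2 * s - 1)) / Complex.Gamma (a + b + (2 * s - 1))) =
      ((Real.Gamma (a + b) / ((2 : ℝ) ^ b * Real.Gamma a) : ℝ) : ℂ) *
        ((Complex.Gamma (s + ((a / 2 : ℝ) : ℂ)) * Complex.Gamma (s + (((a - 1) / 2 : ℝ) : ℂ))) /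
          (Complex.Gamma (s + (((a + b) / 2 : ℝ) : ℂ)) *
            Complex.Gamma (s + (((a + b - 1) / 2 : ℝ) : ℂ)))) := by
  have h1 := Gamma_two_mul_sub_one_add s a
  have h2 := Gamma_two_mul_sub_one_add s (a + b)
  rw [Complex.ofReal_add] at h2
  have e : 2 * s + ((a : ℂ) + b) - 2 = (2 * s + a - 2) + b := by ring
  rw [e, Complex.cpow_add _ _ two_ne_zero] at h2
  rw [h1, h2]
  have hpi : ((Real.sqrt Real.pi : ℝ) : ℂ) ≠ 0 := by
    exact_mod_cast (Real.sqrt_pos.2 Real.pi_pos).ne'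
  have h2 : (2 : ℂ) ^ (2 * s + a - 2) ≠ 0 := by simp [Complex.cpow_eq_zero_iff]
  push_cast [← Complex.Gamma_ofReal, Complex.ofReal_cpow (zero_le_two : (0 : ℝ) ≤ 2)]
  generalize (2 : ℂ) ^ (2 * s + a - 2) = A at *
  simp only [div_eq_mul_inv, mul_inv, inv_inv]
  field_simp

/-- The duplication factor `2^(2s)` combines with `l^(-2s)`: each gamma variable contributes `l²/4`
to the argument. -/
theorem gamma_moment_eq {r l : ℝ} (hl : 0 < l) (s : ℂ) :
    Complex.Gamma (r + (2 * s - 1)) / (Complex.Gamma r * (l : ℂ) ^ (2 * s - 1)) =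
      ((l * (2 : ℝ) ^ r / (4 * Real.sqrt Real.pi * Real.Gamma r) : ℝ) : ℂ) *
        (((l ^ 2 / 4 : ℝ) : ℂ) ^ (-s) *
        (Complex.Gamma (s + ((r / 2 : ℝ) : ℂ)) * Complex.Gamma (s + (((r - 1) / 2 : ℝ) : ℂ)))) := by
  have hl' : (l : ℂ) ≠ 0 := by exact_mod_cast hl.ne'
  have h2 := ofReal_cpow_eq_exp (two_pos : (0 : ℝ) < 2)
  rw [Complex.ofReal_ofNat] at h2
  have hlog : Real.log (l ^ 2 / 4) = 2 * Real.log l - 2 * Real.log 2 := by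
    rw [Real.log_div (by positivity) (by norm_num), Real.log_pow,
      show (4 : ℝ) = 2 ^ 2 by norm_num, Real.log_pow]
    push_cast; ring
  have e : (2 : ℂ) ^ (2 * s + r - 2) * ((l : ℂ) ^ (2 * s - 1))⁻¹ =
      l * (2 : ℂ) ^ (r : ℂ) / 4 * ((l ^ 2 / 4 : ℝ) : ℂ) ^ (-s) := by
    have e1 : (2 : ℂ) ^ (2 * s + r - 2) = (2 : ℂ) ^ (2 * s) * (2 : ℂ) ^ (r : ℂ) / 4 := by
      rw [Complex.cpow_sub _ _ two_ne_zero, Complex.cpow_add _ _ two_ne_zero]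
      norm_num
    have e2 : ((l : ℂ) ^ (2 * s - 1))⁻¹ = l * (l : ℂ) ^ (-(2 * s)) := by
      rw [← Complex.cpow_neg, neg_sub, sub_eq_add_neg, Complex.cpow_add _ _ hl', Complex.cpow_one]
    have e3 : ((l ^ 2 / 4 : ℝ) : ℂ) ^ (-s) = (2 : ℂ) ^ (2 * s) * (l : ℂ) ^ (-(2 * s)) := by
      rw [ofReal_cpow_eq_exp (by positivity), h2, ofReal_cpow_eq_exp hl, ← Complex.exp_add, hlog]
      congr 1
      push_cast; ring
    rw [e1, e2, e3]
    ring
  rw [Gamma_two_mul_sub_one_add]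
  push_cast [← Complex.Gamma_ofReal, Complex.ofReal_cpow (zero_le_two : (0 : ℝ) ≤ 2)] at e ⊢
  simp only [div_eq_mul_inv, mul_inv] at e ⊢
  linear_combination (((Real.sqrt Real.pi : ℝ) : ℂ)⁻¹ * (Complex.Gamma r)⁻¹ *
    (Complex.Gamma (s + r * 2⁻¹) * Complex.Gamma (s + (r - 1) * 2⁻¹))) * e

theorem gaussianAbsMoment_eq {σ : ℝ} (hσ : 0 < σ) (s : ℂ) :
    gaussianAbsMoment σ (2 * s - 1) =
      (((Real.sqrt 2 * Real.sqrt Real.pi * σ)⁻¹ : ℝ) : ℂ) *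
        (((1 / (2 * σ ^ 2) : ℝ) : ℂ) ^ (-s) * Complex.Gamma s) := by
  have hd : 0 < 2 * σ ^ 2 := by positivity
  have e : ((2 * σ ^ 2 : ℝ) : ℂ) ^ ((2 * s - 1) / 2) =
      (((Real.sqrt 2 * σ)⁻¹ : ℝ) : ℂ) * ((1 / (2 * σ ^ 2) : ℝ) : ℂ) ^ (-s) := by
    have hpos : 0 < (Real.sqrt 2 * σ)⁻¹ := by positivity
    have h1 : (((Real.sqrt 2 * σ)⁻¹ : ℝ) : ℂ) =
        Complex.exp ((Real.log (2 * σ ^ 2) : ℝ) * (-1 / 2)) := by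
      rw [← Real.exp_log hpos, Real.log_inv,
        show Real.sqrt 2 * σ = Real.sqrt (2 * σ ^ 2) by
          rw [Real.sqrt_mul zero_le_two, Real.sqrt_sq hσ.le], Real.log_sqrt hd.le]
      push_cast; ring_nf
    rw [h1, ofReal_cpow_eq_exp hd, ofReal_cpow_eq_exp (by positivity), one_div, Real.log_inv,
      ← Complex.exp_add]
    congr 1
    push_cast; ring
  rw [gaussianAbsMoment, e, show (2 * s - 1 + 1) / 2 = s by ring]
  push_cast
  simp only [mul_inv, div_eq_mul_inv]
  ring

theorem meijerGIntegrand_bgn {m n : ℕ} (a b : Fin m → ℝ) (r : Fin n → ℝ) (N : ℕ) (z s : ℂ) :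
    meijerGIntegrand (2 * m + 2 * n + N) 0 (bgnUpper a b) (bgnLower a r N) z s =
      z ^ (-s) * ((∏ i, (Complex.Gamma (s + ((a i / 2 : ℝ) : ℂ)) *
          Complex.Gamma (s + (((a i - 1) / 2 : ℝ) : ℂ))) /
          (Complex.Gamma (s + (((a i + b i) / 2 : ℝ) : ℂ)) *
            Complex.Gamma (s + (((a i + b i - 1) / 2 : ℝ) : ℂ)))) *
        (∏ j, Complex.Gamma (s + ((r j / 2 : ℝ) : ℂ)) *
          Complex.Gamma (s + (((r j - 1) / 2 : ℝ) : ℂ))) * Complex.Gamma s ^ N) := by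
  rw [meijerGIntegrand, List.take_of_length_le (length_bgnLower a r N).le,
    List.drop_of_length_le (length_bgnLower a r N).le, List.take_zero, List.drop_zero, bgnUpper,
    bgnLower]
  simp only [List.map_append, List.prod_append, List.map_ofFn, List.prod_ofFn, List.map_replicate,
    List.prod_replicate, Function.comp_def, List.map_nil, List.prod_nil, add_zero, mul_one,
    Finset.prod_mul_distrib, Finset.prod_div_distrib]
  ring

theorem bgnConst_eq_prod {m n N : ℕ} (a b : Fin m → ℝ) (r : Fin n → ℝ) (l : ℝ) (σ : Fin N → ℝ) :
    bgnConst a b r l N (∏ k, σ k) =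
      (∏ i, Real.Gamma (a i + b i) / ((2 : ℝ) ^ b i * Real.Gamma (a i))) *
      ((∏ j, l * (2 : ℝ) ^ r j / (4 * Real.sqrt Real.pi * Real.Gamma (r j))) *
        ∏ k, (Real.sqrt 2 * Real.sqrt Real.pi * σ k)⁻¹) := by
  have h2 : (2 : ℝ) ^ (2 * (n : ℝ) + (N : ℝ) / 2) = 4 ^ n * Real.sqrt 2 ^ N := by
    rw [Real.rpow_add two_pos, Real.rpow_mul zero_le_two, div_eq_inv_mul,
      Real.rpow_mul zero_le_two, Real.rpow_natCast, Real.rpow_natCast, Real.sqrt_eq_rpow]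
    norm_num
  have h3 : Real.pi ^ (((n : ℝ) + (N : ℝ)) / 2) =
      Real.sqrt Real.pi ^ n * Real.sqrt Real.pi ^ N := by
    rw [← pow_add, Real.sqrt_eq_rpow, ← Real.rpow_natCast, ← Real.rpow_mul Real.pi_pos.le]
    push_cast; ring_nf
  rw [bgnConst, h2, h3]
  simp only [Finset.prod_div_distrib, Finset.prod_mul_distrib, Finset.prod_inv_distrib,
    Finset.prod_const, Finset.card_univ, Fintype.card_fin]
  simp only [div_eq_mul_inv, mul_inv]
  ring

theorem bgn_argument_cpow {n N : ℕ} {l : ℝ} (hl : 0 < l) {σ : Fin N → ℝ}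
    {x : ℝ} (hx : x ≠ 0) (s : ℂ) :
    ((l ^ (2 * n) * x ^ 2 / (2 ^ (2 * n + N) * (∏ k, σ k) ^ 2) : ℝ) : ℂ) ^ (-s) =
      ((|x| : ℝ) : ℂ) ^ (-2 * s) * ((∏ _j : Fin n, ((l ^ 2 / 4 : ℝ) : ℂ) ^ (-s)) *
        ∏ k, ((1 / (2 * σ k ^ 2) : ℝ) : ℂ) ^ (-s)) := by
  have hx' : 0 < |x| := abs_pos.2 hx
  have hA : 0 ≤ ∏ _j : Fin n, l ^ 2 / 4 := Finset.prod_nonneg fun _ _ => by positivity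
  have hB : 0 ≤ ∏ k, 1 / (2 * σ k ^ 2) := Finset.prod_nonneg fun _ _ => by positivity
  have e : l ^ (2 * n) * x ^ 2 / (2 ^ (2 * n + N) * (∏ k, σ k) ^ 2) =
      |x| ^ 2 * ((∏ _j : Fin n, l ^ 2 / 4) * ∏ k, 1 / (2 * σ k ^ 2)) := by
    simp only [Finset.prod_div_distrib, Finset.prod_mul_distrib, Finset.prod_pow,
      Finset.prod_const, Finset.card_univ, Fintype.card_fin, sq_abs, one_pow]
    rw [pow_add, pow_mul, pow_mul]
    norm_num
    field_simp
    ring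
  have hxs : ((|x| ^ 2 : ℝ) : ℂ) ^ (-s) = ((|x| : ℝ) : ℂ) ^ (-2 * s) := by
    rw [ofReal_cpow_eq_exp (by positivity), ofReal_cpow_eq_exp hx', Real.log_pow]
    push_cast; ring_nf
  rw [e, Complex.ofReal_mul, Complex.mul_cpow_ofReal_nonneg (by positivity) (mul_nonneg hA hB), hxs,
    Complex.ofReal_mul, Complex.mul_cpow_ofReal_nonneg hA hB,
    ofReal_prod_cpow _ (fun _ => by positivity), ofReal_prod_cpow _ (fun _ => by positivity)]

/-- The absolute moments of the beta, gamma and normal factors. -/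
def bgnMoment {m n N : ℕ} (a b : Fin m → ℝ) (r : Fin n → ℝ) (l : ℝ) (σ : Fin N → ℝ) :
    Fin m ⊕ (Fin n ⊕ Fin N) → ℂ → ℂ :=
  Sum.elim (fun i s => Complex.Gamma (a i + b i) / Complex.Gamma (a i) *
      (Complex.Gamma (a i + s) / Complex.Gamma (a i + b i + s)))
    (Sum.elim (fun j s => Complex.Gamma (r j + s) / (Complex.Gamma (r j) * (l : ℂ) ^ s))
      fun k => gaussianAbsMoment (σ k))

theorem prod_bgnMoment_eq_meijerGIntegrand {m n N : ℕ} (a b : Fin m → ℝ) (r : Fin n → ℝ) {l : ℝ}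
    (hl : 0 < l) {σ : Fin N → ℝ} (hσ : ∀ k, 0 < σ k) {x : ℝ} (hx : x ≠ 0) (s : ℂ) :
    ((|x| : ℝ) : ℂ) ^ (-2 * s) * ∏ i, bgnMoment a b r l σ i (2 * s - 1) =
      (bgnConst a b r l N (∏ k, σ k) : ℂ) *
        meijerGIntegrand (2 * m + 2 * n + N) 0 (bgnUpper a b) (bgnLower a r N)
          ((l ^ (2 * n) * x ^ 2 / (2 ^ (2 * n + N) * (∏ k, σ k) ^ 2) : ℝ) : ℂ) s := by
  rw [meijerGIntegrand_bgn, bgn_argument_cpow hl hx, bgnConst_eq_prod, Fintype.prod_sum_type,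
    Fintype.prod_sum_type]
  simp only [bgnMoment, Sum.elim_inl, Sum.elim_inr, beta_moment_eq, gamma_moment_eq hl,
    gaussianAbsMoment_eq (hσ _)]
  simp only [Finset.prod_mul_distrib]
  rw [Complex.ofReal_mul, Complex.ofReal_mul, Complex.ofReal_prod, Complex.ofReal_prod,
    Complex.ofReal_prod, Finset.prod_const (Complex.Gamma s), Finset.card_univ, Fintype.card_fin]
  ring

theorem bgnConst_pos {m n N : ℕ} {a b : Fin m → ℝ} (ha : ∀ i, 0 < a i) (hb : ∀ i, 0 < b i)
    {r : Fin n → ℝ} (hr : ∀ j, 0 < r j) {l : ℝ} (hl : 0 < l) {s : ℝ} (hs : 0 < s) :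
    0 < bgnConst a b r l N s := by
  have h1 : ∀ i, 0 < Real.Gamma (a i + b i) / ((2 : ℝ) ^ b i * Real.Gamma (a i)) := fun i => by
    have := Real.Gamma_pos_of_pos (ha i)
    have := Real.Gamma_pos_of_pos (add_pos (ha i) (hb i))
    positivity
  have h2 : ∀ j, 0 < (2 : ℝ) ^ r j / Real.Gamma (r j) := fun j => by
    have := Real.Gamma_pos_of_pos (hr j)
    positivity
  have h3 := Finset.prod_pos fun i (_ : i ∈ Finset.univ) => h1 i
  have h4 := Finset.prod_pos fun j (_ : j ∈ Finset.univ) => h2 j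
  have := Real.pi_pos
  rw [bgnConst]
  positivity

/-- The shifted parameters `(a-1)/2`, `(r-1)/2` impose the stronger conditions, and `N ≥ 1` puts a
zero in the list, giving `0 < c`. The result is exactly what makes all factor moments of order `2c -
1` converge. -/
theorem meijerGSeparates_bgn_iff {m n N : ℕ} (hN : 1 ≤ N) (a b : Fin m → ℝ) (r : Fin n → ℝ)
    (c : ℝ) :
    MeijerGSeparates (2 * m + 2 * n + N) 0 (bgnUpper a b) (bgnLower a r N) c ↔
      (∀ i, 1 - a i < 2 * c) ∧ (∀ j, 1 - r j < 2 * c) ∧ 0 < c := by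
  rw [MeijerGSeparates, List.take_of_length_le (length_bgnLower a r N).le, List.take_zero, bgnLower]
  have hN' : N ≠ 0 := by omega
  simp only [List.mem_append, List.mem_ofFn, List.mem_replicate, List.not_mem_nil]
  constructor
  · rintro ⟨h, -⟩
    refine ⟨fun i => ?_, fun j => ?_, ?_⟩
    · have := h _ (.inl (.inl (.inl (.inr ⟨i, rfl⟩))))
      rw [Complex.ofReal_re] at this
      linarith
    · have := h _ (.inl (.inr ⟨j, rfl⟩))
      rw [Complex.ofReal_re] at this
      linarith
    · simpa using h 0 (.inr ⟨hN', rfl⟩)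
  · rintro ⟨h1, h2, h3⟩
    refine ⟨?_, by simp⟩
    rintro β ((((⟨i, rfl⟩ | ⟨i, rfl⟩) | ⟨j, rfl⟩) | ⟨j, rfl⟩) | ⟨-, rfl⟩)
    · rw [Complex.ofReal_re]; linarith [h1 i]
    · rw [Complex.ofReal_re]; linarith [h1 i]
    · rw [Complex.ofReal_re]; linarith [h2 j]
    · rw [Complex.ofReal_re]; linarith [h2 j]
    · simpa using h3

/-! ### Assembling the theorem -/

theorem meijerGLineIntegral_eq (m n : ℕ) (a b : List ℂ) (c : ℝ) (z : ℂ) :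
    meijerGLineIntegral m n a b c z = 1 / (2 * Real.pi) *
      ∫ t : ℝ, meijerGIntegrand m n a b z ((c : ℂ) + (t : ℂ) * Complex.I) := by
  rw [meijerGLineIntegral, integral_mul_const]
  have := Complex.I_ne_zero
  field_simp

end

theorem theorem3p1
    {Ω : Type*} [MeasurableSpace Ω] (P : Measure Ω) [IsProbabilityMeasure P]
    (m n N : ℕ) (hN : 1 ≤ N)
    (a b : Fin m → ℝ) (ha : ∀ i, 0 < a i) (hb : ∀ i, 0 < b i)
    (r : Fin n → ℝ) (hr : ∀ j, 0 < r j) (l : ℝ) (hl : 0 < l)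
    (σ : Fin N → ℝ) (hσ : ∀ k, 0 < σ k)
    (X : Fin m → Ω → ℝ) (Y : Fin n → Ω → ℝ) (Z : Fin N → Ω → ℝ)
    (hX : ∀ i, HasLaw (X i) (betaMeasure (a i) (b i)) P)
    (hY : ∀ j, HasLaw (Y j) (gammaMeasure (r j) l) P)
    (hZ : ∀ k, HasLaw (Z k) (gaussianReal 0 (Real.toNNReal (σ k ^ 2))) P)
    (hindep : iIndepFun (Sum.elim X (Sum.elim Y Z)) P) :
    ∃ p : ℝ → ℝ, Measurable p ∧ (∀ x, 0 ≤ p x) ∧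
      (∀ x : ℝ, x ≠ 0 →
        HasMeijerG (2 * m + 2 * n + N) 0 (bgnUpper a b) (bgnLower a r N)
          ((l ^ (2 * n) * x ^ 2 / (2 ^ (2 * n + N) * (∏ k, σ k) ^ 2) : ℝ) : ℂ)
          (meijerG (2 * m + 2 * n + N) 0 (bgnUpper a b) (bgnLower a r N)
            ((l ^ (2 * n) * x ^ 2 / (2 ^ (2 * n + N) * (∏ k, σ k) ^ 2) : ℝ) : ℂ)) ∧
        (p x : ℂ) = (bgnConst a b r l N (∏ k, σ k) : ℂ) *
          meijerG (2 * m + 2 * n + N) 0 (bgnUpper a b) (bgnLower a r N)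
            ((l ^ (2 * n) * x ^ 2 / (2 ^ (2 * n + N) * (∏ k, σ k) ^ 2) : ℝ) : ℂ)) ∧
      HasLaw (fun ω => (∏ i, X i ω) * (∏ j, Y j ω) * ∏ k, Z k ω)
        (volume.withDensity fun x => ENNReal.ofReal (p x)) P := by
  have hac : ∀ i, P.map (Sum.elim X (Sum.elim Y Z) i) ≪ volume := by
    rintro (i | j | k)
    · rw [Sum.elim_inl, (hX i).map_eq]
      exact withDensity_absolutelyContinuous _ _
    · rw [Sum.elim_inr, Sum.elim_inl, (hY j).map_eq]
      exact withDensity_absolutelyContinuous _ _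
    · rw [Sum.elim_inr, Sum.elim_inr, (hZ k).map_eq]
      exact gaussianReal_absolutelyContinuous _
        (Real.toNNReal_pos.2 (pow_pos (hσ k) 2)).ne'
  have hU : ∀ i, AEMeasurable (Sum.elim X (Sum.elim Y Z) i) P := by
    rintro (i | j | k)
    exacts [(hX i).aemeasurable, (hY j).aemeasurable, (hZ k).aemeasurable]
  have hsep := meijerGSeparates_bgn_iff hN a b r
  have hM : ∀ c ∈ {c | MeijerGSeparates (2 * m + 2 * n + N) 0 (bgnUpper a b) (bgnLower a r N) c},
      ∀ t : ℝ, ∀ i, HasAbsMoment (P.map (Sum.elim X (Sum.elim Y Z) i))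
        (2 * ((c : ℂ) + t * Complex.I) - 1)
        (bgnMoment a b r l σ i (2 * ((c : ℂ) + t * Complex.I) - 1)) := by
    intro c hc t
    obtain ⟨h1, h2, h3⟩ := (hsep c).1 hc
    have hre : (2 * ((c : ℂ) + t * Complex.I) - 1).re = 2 * c - 1 := by simp
    rintro (i | j | k)
    · rw [Sum.elim_inl, (hX i).map_eq]
      exact hasAbsMoment_beta (ha i) (hb i) (by rw [hre]; linarith [h1 i])
    · rw [Sum.elim_inr, Sum.elim_inl, (hY j).map_eq]
      exact hasAbsMoment_gamma (hr j) hl (by rw [hre]; linarith [h2 j])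
    · rw [Sum.elim_inr, Sum.elim_inr, (hZ k).map_eq]
      exact hasAbsMoment_gaussian (hσ k) (by rw [hre]; linarith)
  -- The line `Re s = 1` corresponds to moments of order with real part `1`, which always exist
  -- here.
  have hone : MeijerGSeparates (2 * m + 2 * n + N) 0 (bgnUpper a b) (bgnLower a r N) 1 :=
    (hsep 1).2 ⟨fun i => by linarith [ha i], fun j => by linarith [hr j], one_pos⟩
  -- The distinguished normal factor is the one of index `0`, available since `1 ≤ N`; `C` is the
  -- set of all separating abscissas.
  obtain ⟨p, hpm, hp0, hlaw, hp⟩ := exists_density_prod_of_gaussian_factor hU hindep hac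
    (.inr (.inr ⟨0, hN⟩)) (hσ _) (hZ _) ⟨1, hone⟩ (fun c hc => ((hsep c).1 hc).2.2) hM rfl
  have hσ0 : 0 < ∏ k, σ k := Finset.prod_pos fun k _ => hσ k
  have hK : (bgnConst a b r l N (∏ k, σ k) : ℂ) ≠ 0 :=
    Complex.ofReal_ne_zero.2 (bgnConst_pos ha hb hr hl hσ0).ne'
  -- The value `p x / K` does not involve `c`, so existence and independence of the line are
  -- obtained together.
  have hG : ∀ x : ℝ, x ≠ 0 →
      HasMeijerG (2 * m + 2 * n + N) 0 (bgnUpper a b) (bgnLower a r N)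
        ((l ^ (2 * n) * x ^ 2 / (2 ^ (2 * n + N) * (∏ k, σ k) ^ 2) : ℝ) : ℂ)
        (p x / (bgnConst a b r l N (∏ k, σ k) : ℂ)) := by
    intro x hx
    refine ⟨Complex.ofReal_ne_zero.2 (by positivity), ⟨1, hone⟩, fun c hc => ?_, fun c hc => ?_⟩
    · have := (hp c hc x hx).1
      simp only [prod_bgnMoment_eq_meijerGIntegrand a b r hl hσ hx] at this
      exact (integrable_const_mul_iff (isUnit_iff_ne_zero.2 hK) _).1 this
    · have := (hp c hc x hx).2
      simp only [prod_bgnMoment_eq_meijerGIntegrand a b r hl hσ hx] at this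
      rw [this, integral_const_mul, meijerGLineIntegral_eq, eq_div_iff hK]
      ring
  refine ⟨p, hpm, hp0, fun x hx => ?_, ?_⟩
  · rw [(hG x hx).meijerG_eq]
    exact ⟨hG x hx, (mul_div_cancel₀ _ hK).symm⟩
  · convert hlaw using 2 with ω
    simp [Fintype.prod_sum_type, mul_assoc]
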